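/- For a real-valued potential $r\in L^2([0,1])$ let $\mathcal{T}_r=-\frac{d^2}{dx^2}+r$ be the Sturm–Liouville operator on $[0,1]$ with Dirichlet boundary conditions. Its spectrum $\operatorname{Spec}(\mathcal{T}_r)$ is the set of all $\lambda\in\mathbb{R}$ for which $-y''+ry=\lambda y$, $y(0)=y(1)=0$ has a solution $y\not\equiv 0$ (with $y\in C^1([0,1])$, $y'$ absolutely continuous, and the equation satisfied almost everywhere); all these eigenvalues are simple. Two potentials $r$ and $s$ are called quasi-isospectral if their spectra agree with the exception of one eigenvalue, i.e. if there are $a\in\operatorname{Spec}(\mathcal{T}_r)$ and $b\in\operatorname{Spec}(\mathcal{T}_s)$ such that $\operatorname{Spec}(\mathcal{T}_r)\setminus\{a\}=\operatorname{Spec}(\mathcal{T}_s)\setminus\{b\}$. Theorem. Let $q\in C^\infty([0,1])$ be real-valued and let $p\in L^2([0,1])$ be a real-valued potential such that $q$ and $p$ are quasi-isospectral. Then $$\int_0^1 q(x)\,dx=\int_0^1 p(x)\,dx.$$ -/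

import Mathlib

open scoped ContDiff

namespace SturmLiouville

/-- `y` is a solution on `[0, 1]` of the Dirichlet problem `-y'' + q y = μ y`, `y 0 = 0 = y 1`, with
real potential `q`. As is standard for potentials that are only square integrable, `y` is
continuously differentiable on `[0, 1]`, its derivative `y'` (one-sided at the end points) is
absolutely continuous, and the equation holds almost everywhere; that is, `y` lies in
`H² ∩ H¹₀`, the domain of the operator `-d²/dx² + q` with Dirichlet boundary conditions. -/
structure IsDirichletSolution (q : ℝ → ℝ) (μ : ℝ) (y : ℝ → ℝ) : Prop where
  equation : ∃ y' : ℝ → ℝ,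
    (∀ x ∈ Set.Icc (0 : ℝ) 1, HasDerivWithinAt y (y' x) (Set.Icc 0 1) x) ∧
    AbsolutelyContinuousOnInterval y' 0 1 ∧
    ∀ᵐ x ∂(MeasureTheory.volume.restrict (Set.Icc (0 : ℝ) 1)),
      ∃ y'' : ℝ, HasDerivAt y' y'' x ∧ -y'' + q x * y x = μ * y x
  left_boundary : y 0 = 0
  right_boundary : y 1 = 0

/-- The Dirichlet spectrum of `-d²/dx² + q` on `[0, 1]`: the numbers `μ` for which the Dirichlet
problem has a solution that does not vanish identically on `[0, 1]`. The operator is self-adjoint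
with compact resolvent, so its spectrum is real and consists of eigenvalues, and all of them are
simple, so the set carries the multiplicities. -/
def dirichletSpectrum (q : ℝ → ℝ) : Set ℝ :=
  {μ | ∃ y : ℝ → ℝ, IsDirichletSolution q μ y ∧ ∃ x ∈ Set.Icc (0 : ℝ) 1, y x ≠ 0}

/-- Two potentials are quasi-isospectral if their Dirichlet spectra agree except for one eigenvalue:
after one eigenvalue is removed from each spectrum, the rest is the same. -/
def QuasiIsospectral (q p : ℝ → ℝ) : Prop :=
  ∃ a ∈ dirichletSpectrum q, ∃ b ∈ dirichletSpectrum p,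
    dirichletSpectrum q \ {a} = dirichletSpectrum p \ {b}

end SturmLiouville

open scoped ContDiff
open Set MeasureTheory Filter Topology

namespace SturmLiouville

/-! If `k ^ 2` is a Dirichlet eigenvalue of `r` and `k` is large, the eigenfunction is nearly a
multiple of `sin (k x)`. Inserting this into the variation-of-constants formula at `x = 1` and
applying Riemann–Lebesgue gives `k sin k = cos k · (∫ r) / 2 + o(1)`
(`eventually_abs_mul_sin_sub_le`). For a common eigenvalue of `q` and `p`, subtracting the two
relations gives `cos k · (∫ q - ∫ p) = o(1)`, while `sin k = O(1 / k)` keeps `|cos k|` away from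
`0`. Hence arbitrarily large common eigenvalues force equal means; no numbering of eigenvalues is
needed. Dropping one eigenvalue from each spectrum does not affect large ones, so it remains to see
that the spectrum of `q` is unbounded above. This follows from the Prüfer angle and the intermediate
value theorem (`frequently_sq_mem_dirichletSpectrum`). -/

/-- A function with continuous derivative on a compact interval is absolutely continuous. -/
theorem absolutelyContinuousOnInterval_of_hasDerivWithinAt {f f' : ℝ → ℝ} {a b : ℝ} (hab : a ≤ b)
    (hf : ∀ x ∈ Icc a b, HasDerivWithinAt f (f' x) (Icc a b) x)
    (hf' : ContinuousOn f' (Icc a b)) : AbsolutelyContinuousOnInterval f a b := by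
  obtain ⟨C, hC⟩ := isCompact_Icc.exists_bound_of_continuousOn hf'
  refine LipschitzOnWith.absolutelyContinuousOnInterval (K := C.toNNReal) ?_
  rw [uIcc_of_le hab]
  refine (convex_Icc a b).lipschitzOnWith_of_nnnorm_hasDerivWithin_le hf fun x hx => ?_
  rw [← NNReal.coe_le_coe, coe_nnnorm]
  exact (hC x hx).trans (Real.le_coe_toNNReal C)

/-! ### Asymptotic equation for large eigenvalues. -/

/-- Variation of constants for `-y'' + r y = k² y` with `y 0 = 0`. -/
theorem variation_of_constants {r y y' : ℝ → ℝ} {k : ℝ}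
    (hy : ∀ x ∈ Icc (0 : ℝ) 1, HasDerivWithinAt y (y' x) (Icc 0 1) x)
    (hy' : AbsolutelyContinuousOnInterval y' 0 1)
    (heq : ∀ᵐ x ∂(volume.restrict (Icc (0 : ℝ) 1)),
      ∃ y'' : ℝ, HasDerivAt y' y'' x ∧ -y'' + r x * y x = k ^ 2 * y x)
    (hy0 : y 0 = 0) {x : ℝ} (hx : x ∈ Icc (0 : ℝ) 1) :
    k * y x = y' 0 * Real.sin (k * x) + ∫ t in (0 : ℝ)..x, Real.sin (k * (x - t)) * (r t * y t) := by
  have hsub : uIcc 0 x ⊆ uIcc (0 : ℝ) 1 := by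
    rw [uIcc_of_le hx.1, uIcc_of_le zero_le_one]; exact Icc_subset_Icc_right hx.2
  have hyc : AbsolutelyContinuousOnInterval y 0 x := by
    refine (absolutelyContinuousOnInterval_of_hasDerivWithinAt zero_le_one hy ?_).mono hsub
    simpa [uIcc_of_le] using hy'.continuousOn
  have hs : AbsolutelyContinuousOnInterval (fun t => Real.sin (k * (x - t))) 0 x :=
    ContDiffOn.absolutelyContinuousOnInterval (by fun_prop)
  have hc : AbsolutelyContinuousOnInterval (fun t => k * Real.cos (k * (x - t))) 0 x :=
    ContDiffOn.absolutelyContinuousOnInterval (by fun_prop)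
  -- This is the Wronskian of `y` and `t ↦ sin (k (x - t))`; the `k ^ 2` terms cancel in its
  -- derivative.
  have hF := (((hy'.mono hsub).fun_mul hs).fun_add (hyc.fun_mul hc)).integral_deriv_eq_sub
  have hcongr : ∫ t in (0 : ℝ)..x, deriv (fun t => y' t * Real.sin (k * (x - t)) +
      y t * (k * Real.cos (k * (x - t)))) t =
      ∫ t in (0 : ℝ)..x, Real.sin (k * (x - t)) * (r t * y t) := by
    refine intervalIntegral.integral_congr_ae ?_
    rw [ae_restrict_iff' measurableSet_Icc] at heq
    have h1 : ∀ᵐ t : ℝ, t ≠ 1 := by simp [ae_iff, measure_singleton]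
    filter_upwards [heq, h1] with t ht ht1 htx
    rw [uIoc_of_le hx.1] at htx
    have htI : t ∈ Icc (0 : ℝ) 1 := ⟨htx.1.le, htx.2.trans hx.2⟩
    obtain ⟨y'', hd, he⟩ := ht htI
    have hyt : HasDerivAt y (y' t) t :=
      (hy t htI).hasDerivAt (Icc_mem_nhds htx.1 (lt_of_le_of_ne htI.2 ht1))
    have hl : HasDerivAt (fun t => k * (x - t)) (-k) t := by
      simpa using ((hasDerivAt_id t).const_sub x).const_mul k
    have := ((hd.fun_mul hl.sin).fun_add (hyt.fun_mul (hl.cos.const_mul k))).deriv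
    rw [this]
    linear_combination (-Real.sin (k * (x - t))) * he
  rw [hcongr] at hF
  rw [hF]
  simp [hy0]
  ring

/-- Variation of constants, estimated: an eigenfunction for a large eigenvalue `k²` is close to a
multiple of `sin (k x)`, and the boundary condition at `1` turns into an equation for `k`. -/
theorem abs_mul_sin_add_integral_le {r : ℝ → ℝ} (hr : IntegrableOn r (Icc 0 1)) {k : ℝ}
    (hk : 0 < k) (hkr : 2 * ∫ t in (0 : ℝ)..1, |r t| ≤ k) (hspec : k ^ 2 ∈ dirichletSpectrum r) :
    |k * Real.sin k + ∫ t in (0 : ℝ)..1, Real.sin (k * (1 - t)) * (r t * Real.sin (k * t))| ≤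
      2 * (∫ t in (0 : ℝ)..1, |r t|) ^ 2 / k := by
  obtain ⟨y, ⟨⟨y', hy, hy', heq⟩, hy0, hy1⟩, x₀, hx₀, hne⟩ := hspec
  have hvar := fun x (hx : x ∈ Icc (0 : ℝ) 1) => variation_of_constants hy hy' heq hy0 hx
  set R := ∫ t in (0 : ℝ)..1, |r t| with hR
  set A := y' 0
  have hycont : ContinuousOn y (Icc 0 1) := fun x hx => (hy x hx).continuousWithinAt
  have hri : IntervalIntegrable r volume 0 1 :=
    (intervalIntegrable_iff_integrableOn_Icc_of_le zero_le_one).2 hr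
  have hR0 : 0 ≤ R := intervalIntegral.integral_nonneg zero_le_one fun _ _ => abs_nonneg _
  have hbound : ∀ (g : ℝ → ℝ) (B x : ℝ), x ∈ Icc (0 : ℝ) 1 → (∀ t ∈ Icc (0 : ℝ) 1, |g t| ≤ B) →
      |∫ t in (0 : ℝ)..x, Real.sin (k * (x - t)) * (r t * g t)| ≤ R * B := by
    intro g B x hx hg
    have hB : 0 ≤ B := (abs_nonneg _).trans (hg 0 (by simp))
    calc |∫ t in (0 : ℝ)..x, Real.sin (k * (x - t)) * (r t * g t)|
        ≤ ∫ t in (0 : ℝ)..x, |r t| * B := by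
          rw [← Real.norm_eq_abs]
          refine intervalIntegral.norm_integral_le_of_norm_le hx.1 (ae_of_all _ fun t ht => ?_) ?_
          · rw [norm_mul, norm_mul]
            calc ‖Real.sin (k * (x - t))‖ * (‖r t‖ * ‖g t‖) ≤ 1 * (|r t| * B) := by
                  refine mul_le_mul (Real.abs_sin_le_one _) ?_ (by positivity) zero_le_one
                  exact mul_le_mul_of_nonneg_left (hg t ⟨ht.1.le, ht.2.trans hx.2⟩) (abs_nonneg _)
              _ = |r t| * B := one_mul _
          · refine (hri.abs.mono_set ?_).mul_const B
            rw [uIcc_of_le hx.1, uIcc_of_le zero_le_one]; exact Icc_subset_Icc_right hx.2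
      _ = (∫ t in (0 : ℝ)..x, |r t|) * B := intervalIntegral.integral_mul_const _ _
      _ ≤ R * B := by
          refine mul_le_mul_of_nonneg_right ?_ hB
          exact intervalIntegral.integral_mono_interval le_rfl hx.1 hx.2
            (ae_of_all _ fun _ => abs_nonneg _) hri.abs
  obtain ⟨z, hz, hzmax⟩ := isCompact_Icc.exists_isMaxOn ⟨x₀, hx₀⟩ hycont.abs
  set M := |y z| with hM
  have hMy : ∀ t ∈ Icc (0 : ℝ) 1, |y t| ≤ M := fun t ht => hzmax ht
  have hMpos : 0 < M := (abs_pos.2 hne).trans_le (hMy x₀ hx₀)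
  have hdiff : ∀ x ∈ Icc (0 : ℝ) 1, |k * y x - A * Real.sin (k * x)| ≤ R * M := by
    intro x hx
    rw [hvar x hx, add_sub_cancel_left]
    exact hbound y M x hx hMy
  -- At the maximum point `k M ≤ |A| + R M`, and `R ≤ k / 2` absorbs the last term.
  have hkM : k * M ≤ 2 * |A| := by
    have h1 := hdiff z hz
    have h2 : |A * Real.sin (k * z)| ≤ |A| := by
      rw [abs_mul]; exact mul_le_of_le_one_right (abs_nonneg _) (Real.abs_sin_le_one _)
    have h3 : |k * y z| = k * M := by rw [abs_mul, abs_of_pos hk]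
    have h4 := abs_sub_abs_le_abs_sub (k * y z) (A * Real.sin (k * z))
    nlinarith
  have hA : 0 < |A| := by nlinarith
  have hend := hvar 1 (by simp)
  rw [hy1, mul_zero, mul_one] at hend
  have hint : ∀ g : ℝ → ℝ, ContinuousOn g (Icc 0 1) → IntervalIntegrable
      (fun t => Real.sin (k * (1 - t)) * (r t * g t)) volume 0 1 := by
    intro g hg
    rw [← uIcc_of_le zero_le_one] at hg
    exact (hri.mul_continuousOn hg).continuousOn_mul (by fun_prop)
  -- Replacing `k y` by `A sin (k t)` in the boundary condition leaves an error quadratic in `R`.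
  have hkey : A * (k * Real.sin k +
      ∫ t in (0 : ℝ)..1, Real.sin (k * (1 - t)) * (r t * Real.sin (k * t))) =
      -∫ t in (0 : ℝ)..1, Real.sin (k * (1 - t)) * (r t * (k * y t - A * Real.sin (k * t))) := by
    have h1 : ∫ t in (0 : ℝ)..1, Real.sin (k * (1 - t)) * (r t * (k * y t - A * Real.sin (k * t))) =
        k * (∫ t in (0 : ℝ)..1, Real.sin (k * (1 - t)) * (r t * y t)) -
        A * ∫ t in (0 : ℝ)..1, Real.sin (k * (1 - t)) * (r t * Real.sin (k * t)) := by
      rw [← intervalIntegral.integral_const_mul, ← intervalIntegral.integral_const_mul,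
        ← intervalIntegral.integral_sub ((hint y hycont).const_mul k)
          ((hint _ (by fun_prop)).const_mul A)]
      congr 1; ext t; ring
    rw [h1]
    linear_combination (-k) * hend
  have h5 := hbound _ _ 1 (by simp) hdiff
  rw [← abs_neg, ← hkey, abs_mul] at h5
  rw [le_div_iff₀ hk]
  refine le_of_mul_le_mul_left ?_ hA
  calc |A| * (_ * k) = k * (|A| * _) := by ring
    _ ≤ k * (R * (R * M)) := mul_le_mul_of_nonneg_left h5 hk.le
    _ = R ^ 2 * (k * M) := by ring
    _ ≤ R ^ 2 * (2 * |A|) := mul_le_mul_of_nonneg_left hkM (sq_nonneg _)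
    _ = |A| * (2 * R ^ 2) := by ring

/-- The Riemann–Lebesgue lemma for the oscillation `cos (k (2 t - 1))` on `[0, 1]`. -/
theorem tendsto_integral_cos_mul (r : ℝ → ℝ) (hr : IntegrableOn r (Icc 0 1)) :
    Tendsto (fun k : ℝ => ∫ t in (0 : ℝ)..1, Real.cos (k * (2 * t - 1)) * r t) atTop (𝓝 0) := by
  have hRL := Real.tendsto_integral_exp_smul_cocompact
    ((Ioc (0 : ℝ) 1).indicator fun t => (r t : ℂ))
  -- `Real.fourierChar` carries a factor `2π`, so frequency `k / π` produces `exp (-2 i k t)`.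
  have hk : Tendsto (fun k : ℝ => k * (1 / Real.pi)) atTop (cocompact ℝ) :=
    (tendsto_id.atTop_mul_const (by positivity)).mono_right atTop_le_cocompact
  have hlim := (hRL.comp hk).norm
  rw [norm_zero] at hlim
  refine squeeze_zero_norm (fun k => ?_) hlim
  set G : ℝ → ℂ := fun t => Real.fourierChar (-(t * (k * (1 / Real.pi)))) • (r t : ℂ)
  have hri : Integrable r (volume.restrict (Ioc 0 1)) := hr.mono_set Ioc_subset_Icc_self
  have hG : Integrable G (volume.restrict (Ioc 0 1)) :=
    hri.ofReal.bdd_mul (c := 1) (by fun_prop) (ae_of_all _ fun t => (Circle.norm_coe _).le)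
  have hind : ∫ v : ℝ, Real.fourierChar (-(v * (k * (1 / Real.pi)))) •
      (Ioc (0 : ℝ) 1).indicator (fun t => (r t : ℂ)) v = ∫ t in Ioc (0 : ℝ) 1, G t := by
    rw [← integral_indicator measurableSet_Ioc]
    congr 1; ext t
    by_cases ht : t ∈ Ioc (0 : ℝ) 1 <;> simp [ht, G]
  have hre : ∫ t in (0 : ℝ)..1, Real.cos (k * (2 * t - 1)) * r t =
      (Complex.exp (k * Complex.I) * ∫ t in Ioc (0 : ℝ) 1, G t).re := by
    rw [← integral_const_mul, intervalIntegral.integral_of_le zero_le_one]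
    refine Eq.trans ?_ (integral_re (hG.const_mul _))
    congr 1; ext t
    have hexp : Complex.exp (k * Complex.I) * G t =
        Complex.exp (((k - 2 * k * t : ℝ) : ℂ) * Complex.I) * (r t : ℂ) := by
      simp only [G, Circle.smul_def, Real.fourierChar_apply, smul_eq_mul]
      rw [← mul_assoc, ← Complex.exp_add]
      congr 2
      have : (Real.pi : ℂ) ≠ 0 := by exact_mod_cast Real.pi_ne_zero
      push_cast
      field_simp
      ring
    rw [hexp]
    simp only [RCLike.re_to_complex, Complex.re_mul_ofReal, Complex.exp_ofReal_mul_I_re]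
    rw [← Real.cos_neg]
    ring_nf
  rw [hre]
  refine (Complex.abs_re_le_norm _).trans ?_
  rw [norm_mul, Complex.norm_exp_ofReal_mul_I, one_mul, Function.comp_apply, hind]

/-- Asymptotics of the Dirichlet eigenvalues `k²` in implicit form. -/
theorem eventually_abs_mul_sin_sub_le {r : ℝ → ℝ} (hr : IntegrableOn r (Icc 0 1)) {ε : ℝ}
    (hε : 0 < ε) : ∀ᶠ k in atTop, k ^ 2 ∈ dirichletSpectrum r →
      |k * Real.sin k - Real.cos k * (∫ t in (0 : ℝ)..1, r t) / 2| ≤ ε := by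
  set R := ∫ t in (0 : ℝ)..1, |r t|
  have hri : IntervalIntegrable r volume 0 1 :=
    (intervalIntegrable_iff_integrableOn_Icc_of_le zero_le_one).2 hr
  have h1 : ∀ᶠ k in atTop, 2 * R ^ 2 / k < ε / 2 :=
    (tendsto_id.const_div_atTop (2 * R ^ 2)).eventually (gt_mem_nhds (half_pos hε))
  have h2 : ∀ᶠ k in atTop, |∫ t in (0 : ℝ)..1, Real.cos (k * (2 * t - 1)) * r t| < ε := by
    simpa using (tendsto_integral_cos_mul r hr).abs.eventually
      (gt_mem_nhds (by simpa using hε))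
  filter_upwards [h1, h2, eventually_ge_atTop (2 * R), eventually_gt_atTop 0]
    with k h1 h2 h3 h4 hspec
  have h5 := (abs_mul_sin_add_integral_le hr h4 h3 hspec).trans h1.le
  -- Product-to-sum: only the non-oscillating term `cos k` survives as `k → ∞`.
  have h6 : ∫ t in (0 : ℝ)..1, Real.sin (k * (1 - t)) * (r t * Real.sin (k * t)) =
      (∫ t in (0 : ℝ)..1, Real.cos (k * (2 * t - 1)) * r t) / 2 -
        Real.cos k * (∫ t in (0 : ℝ)..1, r t) / 2 := by
    rw [mul_div_right_comm, ← intervalIntegral.integral_div,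
      ← intervalIntegral.integral_const_mul, ← intervalIntegral.integral_sub
        ((hri.continuousOn_mul (by fun_prop)).div_const _) (hri.const_mul _)]
    congr 1; ext t
    have e1 : Real.cos (k * (2 * t - 1)) = Real.cos (k * (1 - t) - k * t) := by
      rw [← Real.cos_neg]; ring_nf
    have e2 : Real.cos k = Real.cos (k * (1 - t) + k * t) := by ring_nf
    rw [e1, e2, Real.cos_sub, Real.cos_add]
    ring
  rw [h6] at h5
  rw [abs_le] at h5 ⊢
  rw [abs_lt] at h2
  constructor <;> linarith [h5.1, h5.2, h2.1, h2.2]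

/-! ### Prüfer angle and existence of large eigenvalues. -/

/-- The right-hand side of the equation `θ' = k - (q / k) sin² θ` of the Prüfer angle. -/
noncomputable def pruferField (q : ℝ → ℝ) (k t θ : ℝ) : ℝ := k - q t / k * Real.sin θ ^ 2

theorem lipschitzWith_pruferField {q : ℝ → ℝ} {C : NNReal} (hC : ∀ t, |q t| ≤ C) {k : ℝ}
    (hk : 1 ≤ k) (t : ℝ) : LipschitzWith (2 * C) (pruferField q k t) := by
  refine lipschitzWith_of_nnnorm_deriv_le (𝕜 := ℝ) (by unfold pruferField; fun_prop) fun θ => ?_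
  have hd : HasDerivAt (pruferField q k t) (-(q t / k * (2 * Real.sin θ * Real.cos θ))) θ := by
    have := (((Real.hasDerivAt_sin θ).pow 2).const_mul (q t / k)).const_sub k
    exact this.congr_deriv (by norm_num)
  rw [hd.deriv, ← NNReal.coe_le_coe, coe_nnnorm, norm_neg, norm_mul, norm_mul, norm_mul, norm_div,
    Real.norm_eq_abs k, abs_of_pos (by linarith)]
  have h1 : ‖q t‖ / k ≤ C := (div_le_self (norm_nonneg _) hk).trans (hC t)
  have h2 := Real.abs_sin_le_one θ
  have h3 := Real.abs_cos_le_one θ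
  simp only [Real.norm_eq_abs] at h1 ⊢
  push_cast
  calc |q t| / k * (|2| * |Real.sin θ| * |Real.cos θ|) ≤ C * (2 * 1 * 1) := by
        rw [abs_two]; gcongr
    _ = 2 * C := by ring

/-- The angle moves at nearly constant speed `k`, which yields both existence on all of `[0, 1]` and
the location of `θ 1`. -/
theorem abs_pruferField_sub_le {q : ℝ → ℝ} {C : NNReal} (hC : ∀ t, |q t| ≤ C) {k : ℝ}
    (hk : 1 ≤ k) (hCk : C ≤ k) (t θ : ℝ) : |pruferField q k t θ - k| ≤ 1 := by
  have h : pruferField q k t θ - k = -(q t / k * Real.sin θ ^ 2) := by unfold pruferField; ring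
  rw [h, abs_neg, abs_mul, abs_div, abs_of_pos (by linarith : 0 < k),
    abs_of_nonneg (sq_nonneg (Real.sin θ))]
  exact mul_le_one₀ ((div_le_one (by linarith)).2 ((hC t).trans hCk)) (sq_nonneg _)
    (Real.sin_sq_le_one θ)

/-- The Prüfer angle with initial value `0` exists on all of `[0, 1]`. -/
theorem exists_pruferAngle {q : ℝ → ℝ} (hq : Continuous q) {C : NNReal} (hC : ∀ t, |q t| ≤ C)
    {k : ℝ} (hk : 1 ≤ k) (hCk : C ≤ k) : ∃ θ : ℝ → ℝ, Continuous θ ∧ θ 0 = 0 ∧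
      ∀ t ∈ Icc (0 : ℝ) 1, HasDerivWithinAt θ (pruferField q k t (θ t)) (Icc 0 1) t := by
  -- The radius `k + 1` is the speed bound times the interval length `1`, so one application covers
  -- `[0, 1]`.
  have hP : IsPicardLindelof (pruferField q k) (tmin := 0) (tmax := 1) ⟨0, by simp⟩ 0
      (k + 1).toNNReal 0 (k + 1).toNNReal (2 * C) := by
    refine ⟨fun t _ => (lipschitzWith_pruferField hC hk t).lipschitzOnWith, fun x _ => ?_,
      fun t _ x _ => ?_, ?_⟩
    · unfold pruferField; fun_prop
    · rw [Real.coe_toNNReal _ (by linarith)]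
      have h := abs_le.1 (abs_pruferField_sub_le hC hk hCk t x)
      exact abs_le.2 ⟨by linarith [h.1], by linarith [h.2]⟩
    · simp
  obtain ⟨θ, h0, hθ⟩ := hP.exists_eq_forall_mem_Icc_hasDerivWithinAt₀
  have hθc : ContinuousOn θ (Icc 0 1) := fun t ht => (hθ t ht).continuousWithinAt
  have heq : ∀ t ∈ Icc (0 : ℝ) 1, IccExtend zero_le_one ((Icc (0 : ℝ) 1).domRestrict θ) t = θ t :=
    fun t ht => by rw [IccExtend_of_mem _ _ ht]; rfl
  refine ⟨IccExtend zero_le_one ((Icc (0 : ℝ) 1).domRestrict θ), hθc.domRestrict.Icc_extend', ?_, ?_⟩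
  · rw [heq 0 (by simp)]; exact h0
  · intro t ht
    rw [heq t ht]
    exact (hθ t ht).congr heq (heq t ht)

theorem abs_pruferAngle_one_sub_le {q : ℝ → ℝ} {C : NNReal} (hC : ∀ t, |q t| ≤ C)
    {k : ℝ} (hk : 1 ≤ k) (hCk : C ≤ k) {θ : ℝ → ℝ} (h0 : θ 0 = 0)
    (hθ : ∀ t ∈ Icc (0 : ℝ) 1, HasDerivWithinAt θ (pruferField q k t (θ t)) (Icc 0 1) t) :
    |θ 1 - k| ≤ 1 := by
  have h := (convex_Icc (0 : ℝ) 1).norm_image_sub_le_of_norm_hasDerivWithin_le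
    (f := fun t => θ t - k * t) (C := 1)
    (fun t ht => (hθ t ht).sub ((hasDerivWithinAt_id t _).const_mul k))
    (fun t ht => by simpa using abs_pruferField_sub_le hC hk hCk t (θ t))
    (show (0 : ℝ) ∈ Icc (0 : ℝ) 1 by simp) (show (1 : ℝ) ∈ Icc (0 : ℝ) 1 by simp)
  simpa [h0] using h

/-- The Prüfer angle at the right end point depends continuously on `k`. -/
theorem abs_pruferAngle_one_sub_pruferAngle_one_le {q : ℝ → ℝ} {C : NNReal}
    (hC : ∀ t, |q t| ≤ C) {k l : ℝ} (hk : 1 ≤ k) (hl : 1 ≤ l) {θ η : ℝ → ℝ}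
    (hθc : Continuous θ) (hηc : Continuous η) (hθ0 : θ 0 = 0) (hη0 : η 0 = 0)
    (hθ : ∀ t ∈ Icc (0 : ℝ) 1, HasDerivWithinAt θ (pruferField q k t (θ t)) (Icc 0 1) t)
    (hη : ∀ t ∈ Icc (0 : ℝ) 1, HasDerivWithinAt η (pruferField q l t (η t)) (Icc 0 1) t) :
    |θ 1 - η 1| ≤ gronwallBound 0 (2 * C) ((1 + C) * |k - l|) 1 := by
  have hright : ∀ {f : ℝ → ℝ} {f' t : ℝ}, t ∈ Ico (0 : ℝ) 1 →
      HasDerivWithinAt f f' (Icc 0 1) t → HasDerivWithinAt f f' (Ici t) t := fun ht h =>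
    h.mono_of_mem_nhdsWithin (Icc_mem_nhdsGE_of_mem ht)
  -- Grönwall: `η` solves the equation with parameter `k` up to an error `(1 + C) |k - l|`.
  have := dist_le_of_approx_trajectories_ODE (v := pruferField q k) (K := 2 * C) (a := 0) (b := 1)
    (f := θ) (g := η) (εf := 0) (εg := (1 + C) * |k - l|) (δ := 0)
    (fun t => lipschitzWith_pruferField hC hk t) hθc.continuousOn
    (fun t ht => hright ht (hθ t (Ico_subset_Icc_self ht))) (fun t _ => by simp)
    hηc.continuousOn (fun t ht => hright ht (hη t (Ico_subset_Icc_self ht)))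
    (fun t _ => ?_) (by simp [hθ0, hη0]) 1 (by simp)
  · simpa [Real.dist_eq] using this
  · have hk0 : 0 < k := by linarith
    have hl0 : 0 < l := by linarith
    have h : pruferField q l t (η t) - pruferField q k t (η t) =
        (l - k) * (1 + q t / (k * l) * Real.sin (η t) ^ 2) := by
      unfold pruferField; field_simp; ring
    rw [Real.dist_eq, h, abs_mul, mul_comm, abs_sub_comm l k]
    refine mul_le_mul_of_nonneg_right ((abs_add_le _ _).trans ?_) (abs_nonneg _)
    rw [abs_one, abs_mul, abs_div, abs_of_pos (mul_pos hk0 hl0),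
      abs_of_nonneg (sq_nonneg (Real.sin (η t)))]
    have h1 : |q t| / (k * l) ≤ C :=
      (div_le_self (abs_nonneg _) (one_le_mul_of_one_le_of_one_le hk hl)).trans (hC t)
    have h2 := mul_le_mul h1 (Real.sin_sq_le_one (η t)) (sq_nonneg _) C.2
    simp only [mul_one] at h2
    linarith [h2]

/-- If the Prüfer angle at the right end point is a multiple of `π`, then `k²` is an eigenvalue. -/
theorem sq_mem_dirichletSpectrum_of_pruferAngle {q q₀ : ℝ → ℝ} (hq : Continuous q)
    (hqq : ∀ x ∈ Icc (0 : ℝ) 1, q x = q₀ x) {k : ℝ} (hk : 0 < k)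
    {θ : ℝ → ℝ} (hθc : Continuous θ) (h0 : θ 0 = 0)
    (hθ : ∀ t ∈ Icc (0 : ℝ) 1, HasDerivWithinAt θ (pruferField q k t (θ t)) (Icc 0 1) t)
    (h1 : Real.sin (θ 1) = 0) : k ^ 2 ∈ dirichletSpectrum q₀ := by
  -- Logarithmic derivative of the amplitude `ρ`, chosen so that `y = ρ sin θ` has `y' = k ρ cos θ`.
  set g : ℝ → ℝ := fun t => q t / k * Real.sin (θ t) * Real.cos (θ t)
  have hg : Continuous g := by fun_prop
  set ρ : ℝ → ℝ := fun x => Real.exp (∫ t in (0 : ℝ)..x, g t)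
  have hρ : ∀ x, HasDerivAt ρ (ρ x * g x) x := fun x =>
    (hg.integral_hasStrictDerivAt 0 x).hasDerivAt.exp
  have hρc : Continuous ρ := continuous_iff_continuousAt.2 fun x => (hρ x).continuousAt
  have hρpos : ∀ x, 0 < ρ x := fun x => Real.exp_pos _
  have hy : ∀ x ∈ Icc (0 : ℝ) 1, HasDerivWithinAt (fun x => ρ x * Real.sin (θ x))
      (k * (ρ x * Real.cos (θ x))) (Icc 0 1) x := by
    intro x hx
    refine ((hρ x).hasDerivWithinAt.fun_mul (hθ x hx).sin).congr_deriv ?_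
    simp only [g, pruferField]
    ring
  have hy' : ∀ x ∈ Icc (0 : ℝ) 1, HasDerivWithinAt (fun x => k * (ρ x * Real.cos (θ x)))
      ((q x - k ^ 2) * (ρ x * Real.sin (θ x))) (Icc 0 1) x := by
    intro x hx
    refine (((hρ x).hasDerivWithinAt.fun_mul (hθ x hx).cos).const_mul k).congr_deriv ?_
    simp only [g, pruferField]
    have := Real.sin_sq_add_cos_sq (θ x)
    field_simp
    linear_combination (ρ x * Real.sin (θ x) * q x) * this
  refine ⟨fun x => ρ x * Real.sin (θ x), ⟨⟨fun x => k * (ρ x * Real.cos (θ x)), hy, ?_, ?_⟩,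
    by simp [h0], by simp [h1]⟩, ?_⟩
  · exact absolutelyContinuousOnInterval_of_hasDerivWithinAt zero_le_one hy' (by fun_prop)
  · rw [Measure.restrict_congr_set Ioo_ae_eq_Icc.symm, ae_restrict_iff' measurableSet_Ioo]
    refine ae_of_all _ fun x hx => ⟨_, (hy' x (Ioo_subset_Icc_self hx)).hasDerivAt
      (Icc_mem_nhds hx.1 hx.2), ?_⟩
    rw [hqq x (Ioo_subset_Icc_self hx)]
    ring
  -- A vanishing `y` would contradict `y' 0 = k ρ 0 ≠ 0`.
  · by_contra! hzero
    have hz := (hasDerivWithinAt_const (0 : ℝ) (Icc (0 : ℝ) 1) (0 : ℝ)).congr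
      (fun x hx => hzero x hx) (hzero 0 (by simp))
    have := (uniqueDiffOn_Icc (zero_lt_one' ℝ) 0 (by simp)).eq_deriv _ (hy 0 (by simp)) hz
    simp [h0, hk.ne', (hρpos 0).ne'] at this

/-- The Dirichlet spectrum of a continuous potential is unbounded above. -/
theorem frequently_sq_mem_dirichletSpectrum {q₀ : ℝ → ℝ} (hq₀ : ContinuousOn q₀ (Icc 0 1)) :
    ∃ᶠ k in atTop, k ^ 2 ∈ dirichletSpectrum q₀ := by
  set q : ℝ → ℝ := IccExtend zero_le_one ((Icc (0 : ℝ) 1).domRestrict q₀)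
  have hq : Continuous q := hq₀.domRestrict.Icc_extend'
  have hqq : ∀ t ∈ Icc (0 : ℝ) 1, q t = q₀ t :=
    fun t ht => by simp only [q]; rw [IccExtend_of_mem _ _ ht]; rfl
  obtain ⟨C₀, hC₀⟩ := isCompact_Icc.exists_bound_of_continuousOn hq₀
  set C := C₀.toNNReal
  have hC : ∀ t, |q t| ≤ C := fun t =>
    (hC₀ _ (projIcc (0 : ℝ) 1 zero_le_one t).2).trans (Real.le_coe_toNNReal C₀)
  rw [frequently_atTop]
  intro N
  -- The window `nπ ± 1` then lies above `N`, `1` and `C`; since `|θ k 1 - k| ≤ 1`, the end angle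
  -- passes through `nπ` there.
  obtain ⟨n, hn⟩ := exists_nat_ge (max N (max 1 C) + 1)
  have hnπ : (n : ℝ) ≤ n * Real.pi := by
    have := Real.pi_gt_three
    nlinarith [(Nat.cast_nonneg n : (0 : ℝ) ≤ n)]
  have hle : ∀ k, k ∈ Icc (n * Real.pi - 1) (n * Real.pi + 1) → N ≤ k ∧ 1 ≤ k ∧ C ≤ k := by
    intro k hk
    have : max N (max 1 (C : ℝ)) ≤ k := by linarith [hk.1]
    simpa using this
  have hex : ∀ k : ℝ, ∃ θ : ℝ → ℝ, k ∈ Icc (n * Real.pi - 1) (n * Real.pi + 1) →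
      Continuous θ ∧ θ 0 = 0 ∧
      ∀ t ∈ Icc (0 : ℝ) 1, HasDerivWithinAt θ (pruferField q k t (θ t)) (Icc 0 1) t := by
    intro k
    by_cases hk : k ∈ Icc (n * Real.pi - 1) (n * Real.pi + 1)
    · obtain ⟨θ, h⟩ := exists_pruferAngle hq hC (hle k hk).2.1 (hle k hk).2.2
      exact ⟨θ, fun _ => h⟩
    · exact ⟨0, fun h => absurd h hk⟩
  choose θ hθ using hex
  have hcont : ContinuousOn (fun k => θ k 1) (Icc (n * Real.pi - 1) (n * Real.pi + 1)) := by
    intro k hk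
    rw [ContinuousWithinAt, tendsto_iff_dist_tendsto_zero]
    have hlim : Tendsto (fun l => gronwallBound 0 (2 * C) ((1 + C) * |l - k|) 1)
        (𝓝[Icc (n * Real.pi - 1) (n * Real.pi + 1)] k) (𝓝 0) := by
      have := ((gronwallBound_continuous_ε 0 (2 * C) 1).comp
        (by fun_prop : Continuous fun l => (1 + (C : ℝ)) * |l - k|)).tendsto k
      simp only [Function.comp_def, sub_self, abs_zero, mul_zero, gronwallBound_ε0_δ0] at this
      exact this.mono_left nhdsWithin_le_nhds
    refine squeeze_zero' (Eventually.of_forall fun _ => dist_nonneg) ?_ hlim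
    filter_upwards [self_mem_nhdsWithin] with l hl
    exact abs_pruferAngle_one_sub_pruferAngle_one_le hC (hle l hl).2.1 (hle k hk).2.1
      (hθ l hl).1 (hθ k hk).1 (hθ l hl).2.1 (hθ k hk).2.1 (hθ l hl).2.2 (hθ k hk).2.2
  have hab : n * Real.pi - 1 ≤ n * Real.pi + 1 := by linarith
  have hend : ∀ k, k ∈ Icc (n * Real.pi - 1) (n * Real.pi + 1) → |θ k 1 - k| ≤ 1 := fun k hk =>
    abs_pruferAngle_one_sub_le hC (hle k hk).2.1 (hle k hk).2.2 (hθ k hk).2.1 (hθ k hk).2.2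
  have hl := abs_le.1 (hend _ (left_mem_Icc.2 hab))
  have hr := abs_le.1 (hend _ (right_mem_Icc.2 hab))
  obtain ⟨k, hk, hkπ⟩ := intermediate_value_Icc hab hcont
    (show n * Real.pi ∈ Icc _ _ from ⟨by linarith [hl.2], by linarith [hr.1]⟩)
  refine ⟨k, (hle k hk).1, sq_mem_dirichletSpectrum_of_pruferAngle hq hqq
    (by linarith [(hle k hk).2.1]) (hθ k hk).1 (hθ k hk).2.1 (hθ k hk).2.2 ?_⟩
  simp only at hkπ
  rw [hkπ, Real.sin_nat_mul_pi]

/-! ### Comparison of the means. -/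

/-- Two potentials which have arbitrarily large eigenvalues in common have the same mean. -/
theorem integral_eq_of_frequently_mem_dirichletSpectrum {q p : ℝ → ℝ}
    (hq : IntegrableOn q (Icc 0 1)) (hp : IntegrableOn p (Icc 0 1))
    (h : ∃ᶠ k in atTop, k ^ 2 ∈ dirichletSpectrum q ∧ k ^ 2 ∈ dirichletSpectrum p) :
    ∫ x in (0 : ℝ)..1, q x = ∫ x in (0 : ℝ)..1, p x := by
  set a := ∫ x in (0 : ℝ)..1, q x
  set b := ∫ x in (0 : ℝ)..1, p x
  refine eq_of_forall_dist_le fun ε hε => ?_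
  -- The two estimates give `|cos k| |a - b| / 2 ≤ 2 (ε / 8)`, and `|cos k| ≥ 1 / 2` costs another
  -- factor `2`.
  have hδ : 0 < ε / 8 := by positivity
  obtain ⟨k, ⟨hkq, hkp⟩, h1, h2, h3⟩ := (h.and_eventually
    ((eventually_abs_mul_sin_sub_le hq hδ).and ((eventually_abs_mul_sin_sub_le hp hδ).and
      (eventually_ge_atTop (max 1 (2 * (|a| / 2 + ε / 8))))))).exists
  replace h1 := h1 hkq
  replace h2 := h2 hkp
  have hk1 : 1 ≤ k := (le_max_left _ _).trans h3
  have hka : 2 * (|a| / 2 + ε / 8) ≤ k := (le_max_right _ _).trans h3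
  have hcos1 := Real.abs_cos_le_one k
  have hsin : |Real.sin k| ≤ 1 / 2 := by
    have h4 : |k * Real.sin k| ≤ |a| / 2 + ε / 8 := by
      have h5 : |Real.cos k * a / 2| ≤ |a| / 2 := by
        rw [abs_div, abs_mul, abs_two]
        have := mul_le_of_le_one_left (abs_nonneg a) hcos1
        linarith
      have := abs_sub_abs_le_abs_sub (k * Real.sin k) (Real.cos k * a / 2)
      linarith
    rw [abs_mul, abs_of_pos (by linarith)] at h4
    by_contra! hlt
    nlinarith
  have hcos : 1 / 2 ≤ |Real.cos k| := by
    have h6 := Real.sin_sq_add_cos_sq k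
    rw [← sq_abs (Real.sin k), ← sq_abs (Real.cos k)] at h6
    nlinarith [abs_nonneg (Real.sin k), abs_nonneg (Real.cos k)]
  have h7 : |Real.cos k| * |a - b| ≤ 4 * (ε / 8) := by
    rw [← abs_mul]
    rw [abs_le] at h1 h2 ⊢
    constructor <;> linarith [h1.1, h1.2, h2.1, h2.2]
  rw [Real.dist_eq]
  nlinarith [abs_nonneg (a - b)]

/-- Quasi-isospectral potentials have the same large eigenvalues. -/
theorem QuasiIsospectral.eventually_sq_mem {q p : ℝ → ℝ} (h : QuasiIsospectral q p) :
    ∀ᶠ k : ℝ in atTop, k ^ 2 ∈ dirichletSpectrum q → k ^ 2 ∈ dirichletSpectrum p := by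
  obtain ⟨a, _, b, _, hab⟩ := h
  have hsq : Tendsto (fun k : ℝ => k ^ 2) atTop atTop := tendsto_pow_atTop two_ne_zero
  filter_upwards [hsq.eventually_ne_atTop a] with k hk hkq
  have : k ^ 2 ∈ dirichletSpectrum p \ {b} := hab ▸ ⟨hkq, hk⟩
  exact this.1

end SturmLiouville

theorem mainTheorem2 (q p : ℝ → ℝ)
    (hq : ContDiffOn ℝ ∞ q (Set.Icc 0 1))
    (hp : MeasureTheory.MemLp p 2 (MeasureTheory.volume.restrict (Set.Icc (0 : ℝ) 1)))
    (hqp : SturmLiouville.QuasiIsospectral q p) :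
    ∫ x in (0 : ℝ)..1, q x = ∫ x in (0 : ℝ)..1, p x := by
  refine SturmLiouville.integral_eq_of_frequently_mem_dirichletSpectrum
    (hq.continuousOn.integrableOn_compact isCompact_Icc) (hp.integrable (by norm_num)) ?_
  exact ((SturmLiouville.frequently_sq_mem_dirichletSpectrum hq.continuousOn).and_eventually
    hqp.eventually_sq_mem).mono fun k hk => ⟨hk.1, hk.2 hk.1⟩
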